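/- Let $0<\varepsilon,\delta<1$ and let $s\ge 1$ be an integer. A random matrix $A\in\mathbb{R}^{m\times d}$ is called a ScaledJL$(\varepsilon,\delta,s)$-matrix if for every fixed $x\in\mathbb{R}^d$ $$\mathbb{P}_A\left[\,\|s^{-1/2}Ax\|_2^2\notin\left[(1-\varepsilon)\|x\|_2^2,\,(1+\varepsilon)\|x\|_2^2\right]\,\right]<\delta .$$ There exist universal constants $C>0$ and $0<c<1$ such that the following holds. Let $A\in\mathbb{R}^{m\times d}$ be a ScaledJL$(\varepsilon,\delta,s)$-matrix with $\varepsilon\le 1/4$ and $\delta\le C$, and suppose that $d\ge m$ and $t\,\varepsilon^{-2}\ln(1/\delta)=m$ for a real number $t\ge 1$. Then there is a measurable set $S\subseteq\operatorname{supp}(A)$ of matrices (where $\operatorname{supp}(A)$ is the support of the law of $A$) with $\mathbb{P}_A[A\in S]\ge 1/2$, such that every $B\in S$ has a (nonempty) square submatrix $F$ with $$|\det F|\;\ge\;\left(\frac{c^2 s}{3(et)^2}\right)^{\lceil cm/t\rceil/2},$$ where $e$ is the base of the natural logarithm. -/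

import Mathlib

open MeasureTheory

/-- Real matrices carry the product σ-algebra: a random matrix is measurable iff all of its
entries are. -/
instance matrixMeasurableSpace {ι κ : Type*} : MeasurableSpace (Matrix ι κ ℝ) :=
  inferInstanceAs (MeasurableSpace (ι → κ → ℝ))

/-- For finite index types this is the Borel σ-algebra. -/
instance matrixBorelSpace {ι κ : Type*} [Finite ι] [Finite κ] : BorelSpace (Matrix ι κ ℝ) :=
  haveI := Fintype.ofFinite ι
  haveI := Fintype.ofFinite κ
  inferInstanceAs (BorelSpace (ι → κ → ℝ))

/-- A random matrix `A` with `m` rows and `d` columns, on a probability space `(Ω, P)`, is a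
ScaledJL(ε, δ, s)-matrix if, for every fixed vector `x`, the squared Euclidean norm of
`s^{-1/2} A x` lies in `(1 ± ε) ‖x‖²`, except with probability less than `δ`. -/
structure IsScaledJL {Ω : Type*} [MeasurableSpace Ω] (P : Measure Ω) {m d : ℕ}
    (A : Ω → Matrix (Fin m) (Fin d) ℝ) (ε δ : ℝ) (s : ℕ) : Prop where
  eps_pos : 0 < ε
  eps_lt_one : ε < 1
  delta_pos : 0 < δ
  delta_lt_one : δ < 1
  scale_pos : 0 < s
  measurable : Measurable A
  norm_preserved : ∀ x : EuclideanSpace ℝ (Fin d),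
    P {ω | ‖WithLp.toLp 2 ((s : ℝ) ^ (-(1 / 2) : ℝ) • Matrix.mulVec (A ω) x.ofLp)‖ ^ 2 ∉
        Set.Icc ((1 - ε) * ‖x‖ ^ 2) ((1 + ε) * ‖x‖ ^ 2)} < ENNReal.ofReal δ

/-- `F` is a (nonempty) square submatrix of `B`: it is obtained by keeping `k ≥ 1` of the rows
and `k` of the columns of `B`, in their order. -/
def IsSquareSubmatrix {m d k : ℕ} (F : Matrix (Fin k) (Fin k) ℝ)
    (B : Matrix (Fin m) (Fin d) ℝ) : Prop :=
  0 < k ∧ ∃ (r : Fin k ↪o Fin m) (q : Fin k ↪o Fin d), F = B.submatrix r q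

/-! Put n = ε⁻² ln(1/δ) = m/t and k = ⌈n/4000⌉. By Fubini and Markov, with probability at least 1/2
the matrix B distorts Gaussian vectors with probability at most 2δ. The core claim,
`exists_le_norm_sub_starProjection_sq`, is that for such B every subspace W of dimension at most k
misses some column by squared distance at least s/2000.

Suppose W violates this, and let L = s^{-1/2} B. The W-component of Lx depends only on the
projection of x to a subspace V with dim V ≤ k. For a typical Gaussian x, Lx is close to W, while V
carries little of ‖x‖² because k is small against d. Shrinking x along V by √(1 - 3ε) therefore
multiplies ‖Lx‖² by roughly 1 - 3ε and hardly changes ‖x‖², so an undistorted x becomes distorted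
(`norm_map_dilation_sq_lt`). The cross term between the two parts of Lx may have the wrong sign;
reflecting x in V flips it and preserves the Gaussian measure. Hence the shrunken vector is
distorted with probability p ≥ 1/4. But shrinking in so few directions changes the Gaussian law too
little for that: by Cauchy–Schwarz (`stdGaussian_preimage_dilation_sq_le`), p² ≤ (1 - 9ε²)^{-k/2} ·
2δ ≤ 2√δ, which is too small.

Given the claim, columns are picked greedily so that all k Gram–Schmidt residuals are at least
√(s/2000). Their Gram determinant is then at least (s/2000)^k, and averaging Cauchy–Binet over the
m^k row selections produces a minor with det² ≥ k! (s/2000)^k / m^k. -/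

/-! ### Large minors from Gram determinants -/

open Matrix in
/-- Averaged form of the Cauchy–Binet formula, over all maps selecting rows. -/
theorem sum_det_submatrix_mul_det_submatrix {m n R : Type*} [Fintype m] [Fintype n]
    [DecidableEq n] [CommRing R] (M N : Matrix m n R) :
    ∑ r : n → m, (M.submatrix r id).det * (N.submatrix r id).det =
      (Fintype.card n).factorial * (Mᵀ * N).det := by
  classical
  have h1 : ∀ σ : Equiv.Perm n, ∑ r : n → m,
      (Equiv.Perm.sign σ : R) * (∏ i, M (r (σ i)) i) * (N.submatrix r id).det =
        (Mᵀ * N).det := by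
    intro σ
    have h2 : (Mᵀ * N).det = ∑ r : n → m, (∏ i, M (r i) i) * (N.submatrix r id).det := by
      rw [← det_transpose, det_apply']
      simp only [det_apply' (N.submatrix _ id), Finset.mul_sum, transpose_apply, mul_apply,
        submatrix_apply, id]
      rw [Finset.sum_comm]
      rw [← Equiv.sum_comp (Equiv.inv (Equiv.Perm n))]
      refine Finset.sum_congr rfl fun τ _ => ?_
      rw [Finset.prod_univ_sum, Finset.mul_sum, Fintype.piFinset_univ]
      refine Finset.sum_congr rfl fun r _ => ?_
      rw [Finset.prod_mul_distrib]
      have : ∏ i, N (r i) ((τ⁻¹) i) = ∏ i, N (r (τ i)) i := by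
        rw [← Equiv.prod_comp τ]; simp
      simp only [Equiv.inv_apply]
      rw [this]
      simp
      ring
    -- Replacing r by r ∘ σ⁻¹ restores the product over M and permutes the rows of the N-minor; the
    -- resulting sign cancels the sign of σ.
    rw [h2, ← (Equiv.arrowCongr σ (Equiv.refl m)).sum_comp]
    refine Finset.sum_congr rfl fun r _ => ?_
    have h3 : N.submatrix ((Equiv.arrowCongr σ (Equiv.refl m)) r) id =
        (N.submatrix r id).submatrix (σ⁻¹ : Equiv.Perm n) id := by
      ext i j; simp [Equiv.arrowCongr]
    rw [h3, det_permute]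
    have h4 : ((Equiv.Perm.sign σ : ℤ) : R) * ((Equiv.Perm.sign σ : ℤ) : R) = 1 := by
      rw [← Int.cast_mul, ← Units.val_mul, Int.units_mul_self]; simp
    simp only [Equiv.Perm.sign_inv, Equiv.arrowCongr_apply, Function.comp_apply,
      Equiv.symm_apply_apply, Equiv.coe_refl, id]
    linear_combination (∏ i, M (r i) i) * (N.submatrix r id).det * h4
  calc _ = ∑ r : n → m, ∑ σ : Equiv.Perm n,
        (Equiv.Perm.sign σ : R) * (∏ i, M (r (σ i)) i) * (N.submatrix r id).det := by
        refine Finset.sum_congr rfl fun r _ => ?_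
        rw [det_apply' (M.submatrix r id), Finset.sum_mul]; rfl
    _ = _ := by
        rw [Finset.sum_comm, Finset.sum_congr rfl fun σ _ => h1 σ]
        simp [Fintype.card_perm]

-- Pigeonhole on the averaged Cauchy–Binet formula with M = N, whose sum has (card m)^(card n)
-- terms.
open Matrix in
theorem exists_factorial_mul_det_le {m n : Type*} [Fintype m] [Fintype n]
    [DecidableEq n] [Nonempty m] (N : Matrix m n ℝ) :
    ∃ r : n → m, (Fintype.card n).factorial * (Nᵀ * N).det ≤
      (Fintype.card m : ℝ) ^ Fintype.card n * (N.submatrix r id).det ^ 2 := by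
  classical
  by_contra! h
  have h1 := sum_det_submatrix_mul_det_submatrix N N
  have h2 : ∑ r : n → m, (Fintype.card m : ℝ) ^ Fintype.card n * (N.submatrix r id).det ^ 2 <
      ∑ _r : n → m, ((Fintype.card n).factorial * (Nᵀ * N).det) :=
    Finset.sum_lt_sum_of_nonempty Finset.univ_nonempty fun r _ => h r
  rw [← Finset.mul_sum] at h2
  simp only [pow_two, h1] at h2
  simp at h2

open InnerProductSpace in
theorem det_gram_eq_prod_norm_gramSchmidt {F : Type*} [NormedAddCommGroup F]
    [InnerProductSpace ℝ F] {k : ℕ} (b : Fin k → F) :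
    (Matrix.of fun i j => inner ℝ (b i) (b j)).det = ∏ i, ‖gramSchmidt ℝ b i‖ ^ 2 := by
  set g := gramSchmidt ℝ b
  -- The unipotent change of basis from g to b; the Gram matrix becomes Rᵀ D R with D diagonal.
  set R : Matrix (Fin k) (Fin k) ℝ := Matrix.of fun i j =>
    if i = j then 1 else if i < j then inner ℝ (g i) (b j) / ‖g i‖ ^ 2 else 0 with hR
  have hb : ∀ j, b j = ∑ i, R i j • g i := by
    intro j
    have h := gramSchmidt_def'' ℝ b j
    rw [h, ← Finset.sum_subset (Finset.subset_univ (Finset.Iic j)), ← Finset.Iio_insert,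
      Finset.sum_insert (by simp)]
    · congr 1
      · simp [hR, g]
      · refine Finset.sum_congr rfl fun i hi => ?_
        have := Finset.mem_Iio.1 hi
        simp [hR, this, this.ne, g]
    · intro i _ hi
      have : j < i := by simpa using hi
      simp [hR, this.ne', this.not_gt]
  have hdet : R.det = 1 := by
    rw [Matrix.det_of_isUpperTriangular]
    · simp [hR]
    · intro i j hij
      have : j < i := hij
      simp [hR, this.ne', this.not_gt]
  have hG : (Matrix.of fun i j => inner ℝ (b i) (b j)) =
      R.transpose * Matrix.diagonal (fun i => ‖g i‖ ^ 2) * R := by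
    ext i j
    rw [Matrix.mul_assoc, Matrix.mul_apply]
    simp only [Matrix.of_apply, Matrix.diagonal_mul, Matrix.transpose_apply]
    rw [hb i, hb j, sum_inner]
    refine Finset.sum_congr rfl fun l _ => ?_
    rw [inner_smul_left, inner_sum, Finset.sum_eq_single l]
    · simp [inner_smul_right, mul_comm]
    · intro l' _ hl
      rw [inner_smul_right, gramSchmidt_orthogonal ℝ b hl.symm, mul_zero]
    · simp
  rw [hG, Matrix.det_mul, Matrix.det_mul, Matrix.det_transpose, hdet, Matrix.det_diagonal]
  simp

-- The Gram–Schmidt residual is b i minus an element of the span of the earlier vectors. That span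
-- lies in W, and the projection minimises the distance to W.
open InnerProductSpace in
theorem norm_sub_starProjection_le_norm_gramSchmidt {F : Type*} [NormedAddCommGroup F]
    [InnerProductSpace ℝ F] [FiniteDimensional ℝ F] {k : ℕ} (b : Fin k → F) (i : Fin k)
    (W : Submodule ℝ F) (hW : ∀ j < i, b j ∈ W) :
    ‖b i - W.starProjection (b i)‖ ≤ ‖gramSchmidt ℝ b i‖ := by
  have h2 : b i - gramSchmidt ℝ b i ∈ W := by
    have h3 : Submodule.span ℝ (b '' Set.Iio i) ≤ W := by
      rw [Submodule.span_le]
      rintro _ ⟨j, hj, rfl⟩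
      exact hW j hj
    apply h3
    rw [gramSchmidt_def, sub_sub_cancel, ← span_gramSchmidt_Iio]
    refine Submodule.sum_mem _ fun j hj => ?_
    rw [Submodule.starProjection_singleton]
    exact Submodule.smul_mem _ _ (Submodule.subset_span ⟨j, Finset.mem_Iio.1 hj, rfl⟩)
  rw [W.starProjection_minimal (b i)]
  have h5 : ⨅ x : W, ‖b i - x‖ ≤ ‖b i - ((⟨_, h2⟩ : W) : F)‖ :=
    ciInf_le ⟨0, by rintro _ ⟨x, rfl⟩; positivity⟩ _
  simpa using h5

/-- Greedy choice of vectors whose Gram–Schmidt residuals are all large. -/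
theorem exists_le_norm_gramSchmidt {F ι : Type*} [NormedAddCommGroup F] [InnerProductSpace ℝ F]
    [FiniteDimensional ℝ F] (a : ι → F) (k : ℕ) (ρ : ℝ)
    (H : ∀ W : Submodule ℝ F, Module.finrank ℝ W < k →
      ∃ j, ρ ≤ ‖a j - W.starProjection (a j)‖) :
    ∃ f : Fin k → ι, ∀ i, ρ ≤ ‖InnerProductSpace.gramSchmidt ℝ (a ∘ f) i‖ := by
  classical
  rcases Nat.eq_zero_or_pos k with rfl | hk
  · exact ⟨Fin.elim0, fun i => i.elim0⟩
  have : Nonempty ι := ⟨(H ⊥ (by simpa using hk)).choose⟩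
  -- The choice is made total, with an arbitrary index once dim W ≥ k, so that the recursion runs
  -- over all of ℕ; only stages below k are used.
  have H' : ∀ W : Submodule ℝ F, ∃ j, Module.finrank ℝ W < k →
      ρ ≤ ‖a j - W.starProjection (a j)‖ := by
    intro W
    by_cases h : Module.finrank ℝ W < k
    · exact (H W h).imp fun j hj _ => hj
    · exact ⟨Classical.arbitrary ι, fun h' => absurd h' h⟩
  choose pick hpick using H'
  obtain ⟨J, hJ0, hJs⟩ : ∃ J : ℕ → Finset F, J 0 = ∅ ∧
      ∀ n, J (n + 1) = insert (a (pick (Submodule.span ℝ (J n : Set F)))) (J n) :=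
    ⟨fun n => Nat.rec ∅ (fun _ K => insert (a (pick (Submodule.span ℝ (K : Set F)))) K) n,
      rfl, fun _ => rfl⟩
  have hcard : ∀ n, (J n).card ≤ n := by
    intro n
    induction n with
    | zero => simp [hJ0]
    | succ n ih => rw [hJs]; exact (Finset.card_insert_le _ _).trans (by omega)
  have hmono : Monotone J := monotone_nat_of_le_succ fun n => by
    rw [hJs]; exact Finset.subset_insert _ _
  refine ⟨fun i => pick (Submodule.span ℝ (J i : Set F)), fun i => ?_⟩
  refine (hpick (Submodule.span ℝ (J i : Set F))
    ((finrank_span_finset_le_card _).trans_lt ((hcard i).trans_lt i.2))).trans ?_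
  refine norm_sub_starProjection_le_norm_gramSchmidt
    (a ∘ fun i : Fin k => pick (Submodule.span ℝ (J i : Set F))) i _ fun j hj => ?_
  apply Submodule.subset_span
  have hj' : (j : ℕ) + 1 ≤ i := hj
  exact hmono hj' (by rw [hJs]; exact Finset.mem_insert_self _ _)

/-- Injective selections of rows and columns give a submatrix, up to sign of the determinant. -/
theorem exists_isSquareSubmatrix_abs_det_eq {m d k : ℕ} (hk : 0 < k)
    (B : Matrix (Fin m) (Fin d) ℝ) (r : Fin k → Fin m) (q : Fin k → Fin d)
    (hr : Function.Injective r) (hq : Function.Injective q) :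
    ∃ F : Matrix (Fin k) (Fin k) ℝ, IsSquareSubmatrix F B ∧ |F.det| = |(B.submatrix r q).det| := by
  have key : ∀ {n : ℕ} (r : Fin k → Fin n), Function.Injective r →
      ∃ (r' : Fin k ↪o Fin n) (e : Fin k ≃ Fin k), ⇑r' = r ∘ e := by
    intro n r hr
    refine ⟨OrderEmbedding.ofStrictMono (r ∘ Tuple.sort r)
      ((Tuple.monotone_sort r).strictMono_of_injective
        (hr.comp (Tuple.sort r).injective)), Tuple.sort r, rfl⟩
  obtain ⟨r', e, hr'⟩ := key r hr
  obtain ⟨q', e', hq'⟩ := key q hq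
  refine ⟨B.submatrix r' q', ⟨hk, r', q', rfl⟩, ?_⟩
  rw [hr', hq', ← Matrix.submatrix_submatrix, Matrix.abs_det_submatrix_equiv_equiv]

/-- If no subspace of dimension less than `k` comes close to all the columns of `B`, then `B` has
a `k × k` submatrix with large determinant. -/
theorem exists_isSquareSubmatrix_le_det_sq {m d k : ℕ} (hk : 0 < k)
    (B : Matrix (Fin m) (Fin d) ℝ) {ρ : ℝ} (hρ : 0 < ρ)
    (H : ∀ W : Submodule ℝ (EuclideanSpace ℝ (Fin m)), Module.finrank ℝ W < k →
      ∃ j, ρ ≤ ‖WithLp.toLp 2 (B.col j) - W.starProjection (WithLp.toLp 2 (B.col j))‖) :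
    ∃ F : Matrix (Fin k) (Fin k) ℝ, IsSquareSubmatrix F B ∧
      k.factorial * (ρ ^ 2) ^ k ≤ (m : ℝ) ^ k * F.det ^ 2 := by
  obtain ⟨q, hq⟩ := exists_le_norm_gramSchmidt (fun j => WithLp.toLp 2 (B.col j)) k ρ H
  have hm : Nonempty (Fin m) := by
    by_contra h
    have hm0 : IsEmpty (Fin m) := not_nonempty_iff.1 h
    have := hq ⟨0, hk⟩
    rw [Subsingleton.elim (InnerProductSpace.gramSchmidt _ _ _) (0 : EuclideanSpace ℝ (Fin m)),
      norm_zero] at this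
    linarith
  set N := B.submatrix id q with hN
  have hgram : (ρ ^ 2) ^ k ≤ (N.transpose * N).det := by
    have h1 := det_gram_eq_prod_norm_gramSchmidt
      ((fun j => (WithLp.toLp 2 (B.col j) : EuclideanSpace ℝ (Fin m))) ∘ q)
    have h2 : N.transpose * N = Matrix.of fun i j => inner ℝ
        (((fun j => (WithLp.toLp 2 (B.col j) : EuclideanSpace ℝ (Fin m))) ∘ q) i)
        (((fun j => (WithLp.toLp 2 (B.col j) : EuclideanSpace ℝ (Fin m))) ∘ q) j) := by
      ext i j
      simp [N, Matrix.mul_apply, PiLp.inner_apply, mul_comm]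
    rw [h2, h1]
    calc (ρ ^ 2) ^ k = ∏ _i : Fin k, ρ ^ 2 := by simp
      _ ≤ _ := Finset.prod_le_prod (fun _ _ => by positivity)
        fun i _ => pow_le_pow_left₀ hρ.le (hq i) 2
  obtain ⟨r, hr⟩ := exists_factorial_mul_det_le N
  simp only [Fintype.card_fin] at hr
  have hle : k.factorial * (ρ ^ 2) ^ k ≤ (m : ℝ) ^ k * (N.submatrix r id).det ^ 2 :=
    (mul_le_mul_of_nonneg_left hgram (by positivity)).trans hr
  -- A nonzero minor has no repeated row or column, so r and q are injective.
  have hne : (N.submatrix r id).det ≠ 0 := by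
    intro h
    rw [h] at hle
    have : 0 < (k.factorial : ℝ) * (ρ ^ 2) ^ k := by positivity
    simp at hle
    linarith
  have hsub : N.submatrix r id = B.submatrix r q := by ext; rfl
  rw [hsub] at hne hle
  obtain ⟨F, hF, hdet⟩ := exists_isSquareSubmatrix_abs_det_eq hk B r q
    (fun i j hij => by
      by_contra hne'
      exact hne (Matrix.det_zero_of_row_eq hne' (by ext; simp [hij])))
    (fun i j hij => by
      by_contra hne'
      exact hne (Matrix.det_zero_of_column_eq hne' (by simp [hij])))
  exact ⟨F, hF, by rwa [← sq_abs F.det, hdet, sq_abs]⟩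

/-! ### Density of the standard Gaussian measure -/

open ProbabilityTheory Real in
theorem stdGaussian_eq_withDensity (E : Type*) [NormedAddCommGroup E] [InnerProductSpace ℝ E]
    [FiniteDimensional ℝ E] [MeasurableSpace E] [BorelSpace E] :
    stdGaussian E = volume.withDensity fun x : E =>
      ENNReal.ofReal (((2 * π) ^ (Module.finrank ℝ E / 2 : ℝ))⁻¹ * exp (-‖x‖ ^ 2 / 2)) := by
  set c : ℝ := ((2 * π) ^ (Module.finrank ℝ E / 2 : ℝ))⁻¹ with hc
  have hc0 : 0 < c := by positivity
  have hint : Integrable (fun x : E => c * exp (-‖x‖ ^ 2 / 2)) := by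
    refine Integrable.const_mul ?_ c
    -- A non-integrable function would have integral 0, while the Gaussian integral formula gives a
    -- positive value.
    by_contra h
    have h1 := GaussianFourier.integral_rexp_neg_mul_sq_norm (V := E) (b := 1 / 2) (by norm_num)
    have h2 : (fun x : E => exp (-(1 / 2) * ‖x‖ ^ 2)) = fun x => exp (-‖x‖ ^ 2 / 2) := by
      ext x; congr 1; ring
    rw [h2, integral_undef h] at h1
    have : 0 < (π / (1 / 2)) ^ (Module.finrank ℝ E / 2 : ℝ) := by positivity
    linarith
  have hfin := isFiniteMeasure_withDensity_ofReal hint.2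
  refine Measure.ext_of_charFun ?_
  ext t
  rw [charFun_stdGaussian, charFun_apply,
    integral_withDensity_eq_integral_toReal_smul (by fun_prop) (by simp)]
  have h3 : ∀ x : E, (ENNReal.ofReal (c * exp (-‖x‖ ^ 2 / 2))).toReal •
      Complex.exp (inner ℝ x t * Complex.I) =
      c * Complex.exp (-(1 / 2 : ℂ) * ‖x‖ ^ 2 + Complex.I * inner ℝ t x) := by
    intro x
    rw [ENNReal.toReal_ofReal (by positivity), Complex.real_smul, real_inner_comm]
    push_cast
    rw [mul_assoc, ← Complex.exp_add]
    congr 2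
    ring
  simp_rw [h3]
  rw [integral_const_mul, GaussianFourier.integral_cexp_neg_mul_sq_norm_add (by norm_num)]
  have h4 : (c : ℂ) * (π / (1 / 2 : ℂ)) ^ (Module.finrank ℝ E / 2 : ℂ) = 1 := by
    have h5 : (π / (1 / 2 : ℂ)) = ((2 * π : ℝ) : ℂ) := by push_cast; ring
    have h6 : (Module.finrank ℝ E / 2 : ℂ) = ((Module.finrank ℝ E / 2 : ℝ) : ℂ) := by
      push_cast; rfl
    rw [h5, h6, ← Complex.ofReal_cpow (by positivity), ← Complex.ofReal_mul, hc,
      inv_mul_cancel₀ (by positivity), Complex.ofReal_one]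
  rw [← mul_assoc, h4, one_mul, Complex.I_sq]
  congr 1
  ring

/-! ### Scaling along a subspace -/

section Dilation

variable {E : Type*} [NormedAddCommGroup E] [InnerProductSpace ℝ E] [FiniteDimensional ℝ E]

/-- The linear map that multiplies by `a` on `V` and is the identity on the orthogonal
complement of `V`. -/
noncomputable def Submodule.dilation (V : Submodule ℝ E) (a : ℝ) : E →L[ℝ] E :=
  ContinuousLinearMap.id ℝ E + (a - 1) • V.starProjection

namespace Submodule

theorem dilation_apply (V : Submodule ℝ E) (a : ℝ) (x : E) :
    V.dilation a x = x + (a - 1) • V.starProjection x := rfl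

theorem starProjection_dilation (V : Submodule ℝ E) (a : ℝ) (x : E) :
    V.starProjection (V.dilation a x) = a • V.starProjection x := by
  have h : V.starProjection (V.starProjection x) = V.starProjection x :=
    V.starProjection_eq_self_iff.2 (V.starProjection_apply_mem x)
  rw [dilation_apply, map_add, map_smul, h]
  module

theorem dilation_dilation (V : Submodule ℝ E) (a b : ℝ) (x : E) :
    V.dilation a (V.dilation b x) = V.dilation (a * b) x := by
  rw [dilation_apply, starProjection_dilation, dilation_apply, dilation_apply]
  module

theorem dilation_one (V : Submodule ℝ E) (x : E) : V.dilation 1 x = x := by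
  simp [dilation_apply]

theorem norm_dilation_sq (V : Submodule ℝ E) (a : ℝ) (x : E) :
    ‖V.dilation a x‖ ^ 2 = ‖x‖ ^ 2 + (a ^ 2 - 1) * ‖V.starProjection x‖ ^ 2 := by
  have h : inner ℝ x (V.starProjection x) = ‖V.starProjection x‖ ^ 2 := by
    have h1 : inner ℝ (V.starProjection x) (x - V.starProjection x) = 0 :=
      V.inner_right_of_mem_orthogonal (V.starProjection_apply_mem x)
        (V.sub_starProjection_mem_orthogonal x)
    rw [inner_sub_right, real_inner_self_eq_norm_sq, real_inner_comm] at h1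
    linarith
  rw [dilation_apply, norm_add_sq_real, inner_smul_right, h, norm_smul, mul_pow,
    Real.norm_eq_abs, sq_abs]
  ring

theorem det_dilation (V : Submodule ℝ E) (a : ℝ) :
    LinearMap.det (V.dilation a : E →ₗ[ℝ] E) = a ^ Module.finrank ℝ V := by
  have hV : V ≤ V.comap (V.dilation a : E →ₗ[ℝ] E) := fun x hx =>
    V.add_mem hx (V.smul_mem _ (V.starProjection_apply_mem x))
  rw [LinearMap.det_eq_det_mul_det V _ hV]
  have h1 : (V.dilation a : E →ₗ[ℝ] E).restrict hV = a • LinearMap.id := by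
    ext x
    have : V.starProjection (x : E) = x := V.starProjection_eq_self_iff.2 x.2
    simp [LinearMap.restrict_apply, dilation_apply, this]
    module
  have h2 : V.mapQ V (V.dilation a : E →ₗ[ℝ] E) hV = LinearMap.id := by
    ext x
    simp [dilation_apply, V.starProjection_apply_mem]
  rw [h1, h2, LinearMap.det_smul]
  simp

theorem lintegral_comp_dilation [MeasurableSpace E] [BorelSpace E] (V : Submodule ℝ E) {a : ℝ}
    (ha : 0 < a) {f : E → ENNReal} (hf : Measurable f) :
    ∫⁻ x, f (V.dilation a x) = ENNReal.ofReal ((a ^ Module.finrank ℝ V)⁻¹) * ∫⁻ x, f x := by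
  have hdet : LinearMap.det (V.dilation a : E →ₗ[ℝ] E) ≠ 0 := by
    rw [det_dilation]; positivity
  have h := Measure.map_linearMap_addHaar_eq_smul_addHaar (volume : Measure E) hdet
  rw [det_dilation, abs_of_pos (by positivity)] at h
  rw [← smul_eq_mul, ← lintegral_smul_measure, ← h]
  exact (lintegral_map hf (V.dilation a).continuous.measurable).symm

end Submodule

end Dilation

/-! ### Gaussian estimates: change of measure and tail bounds -/

section Gaussian

open ProbabilityTheory Real

variable {E : Type*} [NormedAddCommGroup E] [InnerProductSpace ℝ E]

variable (E) in
/-- The density of the standard Gaussian measure, as a function of the squared norm. -/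
noncomputable def gaussianProfile (y : ℝ) : ENNReal :=
  ENNReal.ofReal (((2 * π) ^ (Module.finrank ℝ E / 2 : ℝ))⁻¹ * exp (-y / 2))

@[fun_prop]
theorem measurable_gaussianProfile : Measurable (gaussianProfile E) := by
  unfold gaussianProfile; fun_prop

theorem gaussianProfile_add (y z : ℝ) :
    gaussianProfile E (y + z) = ENNReal.ofReal (exp (-z / 2)) * gaussianProfile E y := by
  rw [gaussianProfile, gaussianProfile, ← ENNReal.ofReal_mul (by positivity)]
  congr 1
  rw [show -(y + z) / 2 = -y / 2 + -z / 2 by ring, exp_add]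
  ring

/-- The logarithm of the profile is affine, so a midpoint becomes a geometric mean, ready for
Cauchy–Schwarz. -/
theorem gaussianProfile_midpoint (y z : ℝ) :
    gaussianProfile E ((y + z) / 2) =
      gaussianProfile E y ^ (1 / 2 : ℝ) * gaussianProfile E z ^ (1 / 2 : ℝ) := by
  simp only [gaussianProfile]
  rw [← ENNReal.mul_rpow_of_nonneg _ _ (by norm_num), ← ENNReal.ofReal_mul (by positivity),
    ENNReal.ofReal_rpow_of_nonneg (by positivity) (by norm_num), ← sqrt_eq_rpow]
  congr 1
  rw [eq_comm, sqrt_eq_iff_mul_self_eq (by positivity) (by positivity)]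
  have h : exp (-((y + z) / 2) / 2) * exp (-((y + z) / 2) / 2) = exp (-y / 2) * exp (-z / 2) := by
    rw [← exp_add, ← exp_add]; congr 1; ring
  linear_combination -((((2 * π) ^ (Module.finrank ℝ E / 2 : ℝ))⁻¹) ^ 2 * h)

variable [FiniteDimensional ℝ E] [MeasurableSpace E] [BorelSpace E]

theorem stdGaussian_apply {Z : Set E} (hZ : MeasurableSet Z) :
    stdGaussian E Z = ∫⁻ x, Z.indicator 1 x * gaussianProfile E (‖x‖ ^ 2) := by
  rw [stdGaussian_eq_withDensity, withDensity_apply _ hZ, ← lintegral_indicator hZ]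
  refine lintegral_congr fun x => ?_
  by_cases hx : x ∈ Z <;> simp [hx, gaussianProfile]

theorem lintegral_gaussianProfile_dilation (V : Submodule ℝ E) {a : ℝ} (ha : 0 < a) :
    ∫⁻ x, gaussianProfile E (‖V.dilation a x‖ ^ 2) =
      ENNReal.ofReal ((a ^ Module.finrank ℝ V)⁻¹) := by
  rw [V.lintegral_comp_dilation ha (f := fun x => gaussianProfile E (‖x‖ ^ 2)) (by fun_prop)]
  have h := stdGaussian_apply (E := E) MeasurableSet.univ
  simp at h
  rw [← h, mul_one]

/-- Comparison of the standard Gaussian measure with its image under a contraction along a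
subspace. -/
theorem stdGaussian_preimage_dilation_sq_le (V : Submodule ℝ E) {σ q : ℝ} (hσ : 0 < σ)
    (hq : 0 < q) (hσq : q ^ 2 = 2 / σ ^ 2 - 1) {Z : Set E} (hZ : MeasurableSet Z) :
    (stdGaussian E).real (V.dilation σ ⁻¹' Z) ^ 2 ≤
      ((σ ^ 2 * q) ^ Module.finrank ℝ V)⁻¹ * (stdGaussian E).real Z := by
  set k := Module.finrank ℝ V
  have h1 : stdGaussian E (V.dilation σ ⁻¹' Z) = ENNReal.ofReal ((σ ^ k)⁻¹) *
      ∫⁻ y, Z.indicator 1 y * gaussianProfile E (‖V.dilation σ⁻¹ y‖ ^ 2) := by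
    rw [stdGaussian_apply (hZ.preimage (V.dilation σ).continuous.measurable),
      ← V.lintegral_comp_dilation hσ
        (f := fun y => Z.indicator 1 y * gaussianProfile E (‖V.dilation σ⁻¹ y‖ ^ 2))
        ((measurable_one.indicator hZ).mul (by fun_prop))]
    refine lintegral_congr fun x => ?_
    rw [V.dilation_dilation, inv_mul_cancel₀ hσ.ne', V.dilation_one]
    rfl
  have h2 : ∀ y, Z.indicator 1 y * gaussianProfile E (‖V.dilation σ⁻¹ y‖ ^ 2) =
      ((fun y => (Z.indicator 1 y * gaussianProfile E (‖y‖ ^ 2)) ^ (1 / 2 : ℝ)) *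
        fun y => gaussianProfile E (‖V.dilation q y‖ ^ 2) ^ (1 / 2 : ℝ)) y := by
    intro y
    -- The choice of q says σ⁻² = (1 + q²)/2, so the density after dilation is the geometric mean of
    -- the original Gaussian density and a Gaussian dilated by q.
    have h3 : ‖V.dilation σ⁻¹ y‖ ^ 2 = (‖y‖ ^ 2 + ‖V.dilation q y‖ ^ 2) / 2 := by
      rw [V.norm_dilation_sq, V.norm_dilation_sq, hσq, inv_pow]
      ring
    rw [h3, gaussianProfile_midpoint, Pi.mul_apply, ENNReal.mul_rpow_of_nonneg _ _ (by norm_num)]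
    by_cases hy : y ∈ Z <;> simp [hy]
  have h4 : ∫⁻ y, Z.indicator 1 y * gaussianProfile E (‖V.dilation σ⁻¹ y‖ ^ 2) ≤
      (stdGaussian E Z) ^ (1 / 2 : ℝ) * ENNReal.ofReal ((q ^ k)⁻¹) ^ (1 / 2 : ℝ) := by
    simp_rw [h2]
    refine (ENNReal.lintegral_mul_le_Lp_mul_Lq volume Real.HolderConjugate.two_two
      ((((measurable_one.indicator hZ).mul (by fun_prop)).pow_const _).aemeasurable)
      (Measurable.aemeasurable (by fun_prop))).trans_eq ?_
    simp only [← ENNReal.rpow_mul]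
    norm_num
    rw [← lintegral_gaussianProfile_dilation V hq, stdGaussian_apply hZ]
  have h5 : stdGaussian E (V.dilation σ ⁻¹' Z) ^ 2 ≤
      ENNReal.ofReal (((σ ^ 2 * q) ^ k)⁻¹) * stdGaussian E Z := by
    rw [h1]
    refine (pow_le_pow_left' (mul_le_mul_right h4 _) 2).trans_eq ?_
    have h6 : ∀ x : ENNReal, (x ^ (1 / 2 : ℝ)) ^ 2 = x := by
      intro x; rw [← ENNReal.rpow_natCast, ← ENNReal.rpow_mul]; norm_num
    rw [mul_pow, mul_pow, h6, h6, ← ENNReal.ofReal_pow (by positivity), mul_comm (stdGaussian E Z),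
      ← mul_assoc, ← ENNReal.ofReal_mul (by positivity)]
    congr 2
    rw [mul_pow, mul_inv, ← inv_pow, ← inv_pow, ← inv_pow, ← inv_pow]
    ring
  have h7 := ENNReal.toReal_mono (by finiteness) h5
  rwa [ENNReal.toReal_pow, ENNReal.toReal_mul, ENNReal.toReal_ofReal (by positivity)] at h7

/-- Chernoff bound: on the event the density is at most exp(d/8) times the profile composed with the
dilation by √2, whose integral is √2^(-d). Since (exp(1/8)/√2)^8 = e/16 ≤ 1/5, dimension 32
suffices. -/
theorem stdGaussian_norm_sq_le (hd : 32 ≤ Module.finrank ℝ E) :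
    (stdGaussian E).real {x | ‖x‖ ^ 2 ≤ Module.finrank ℝ E / 4} ≤ 1 / 50 := by
  set d := Module.finrank ℝ E with hdd
  have hZ : MeasurableSet {x : E | ‖x‖ ^ 2 ≤ d / 4} := measurableSet_le (by fun_prop) (by fun_prop)
  have h1 : stdGaussian E {x | ‖x‖ ^ 2 ≤ d / 4} ≤
      ENNReal.ofReal (exp (1 / 8) ^ d * (√2 ^ d)⁻¹) := by
    rw [stdGaussian_apply hZ, ENNReal.ofReal_mul (by positivity)]
    have h2 := lintegral_gaussianProfile_dilation (⊤ : Submodule ℝ E) (a := √2) (by positivity)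
    rw [finrank_top, ← hdd] at h2
    rw [← h2, ← lintegral_const_mul _ (by fun_prop)]
    refine lintegral_mono fun x => ?_
    by_cases hx : x ∈ {x : E | ‖x‖ ^ 2 ≤ d / 4}
    · simp only [hx, Set.indicator_of_mem, Pi.one_apply, one_mul]
      rw [Submodule.norm_dilation_sq, gaussianProfile_add, ← mul_assoc]
      refine le_mul_of_one_le_left' ?_
      rw [← ENNReal.ofReal_mul (by positivity), ENNReal.one_le_ofReal, ← exp_nat_mul, ← exp_add]
      apply Real.one_le_exp
      have hx' : ‖x‖ ^ 2 ≤ d / 4 := hx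
      rw [Submodule.starProjection_top, Real.sq_sqrt (by norm_num)]
      simp only [ContinuousLinearMap.id_apply]
      linarith
    · simp [hx]
  have h3 : (stdGaussian E).real {x | ‖x‖ ^ 2 ≤ d / 4} ≤ (exp (1 / 8) / √2) ^ d := by
    rw [div_pow]
    exact ENNReal.toReal_le_of_le_ofReal (by positivity) h1
  have h8 : (exp (1 / 8) / √2) ^ 8 ≤ 1 / 5 := by
    rw [div_pow, ← exp_nat_mul, show √2 ^ 8 = (√2 ^ 2) ^ 4 by ring, Real.sq_sqrt (by norm_num)]
    have := Real.exp_one_lt_d9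
    norm_num
    linarith
  have h9 : exp (1 / 8) / √2 ≤ 1 := by
    by_contra! h
    have := one_lt_pow₀ h (n := 8) (by norm_num)
    linarith
  calc _ ≤ _ := h3
    _ ≤ (exp (1 / 8) / √2) ^ 32 := pow_le_pow_of_le_one (by positivity) h9 hd
    _ = ((exp (1 / 8) / √2) ^ 8) ^ 4 := by ring
    _ ≤ (1 / 5) ^ 4 := pow_le_pow_left₀ (by positivity) h8 4
    _ ≤ 1 / 50 := by norm_num

theorem integral_inner_sq_stdGaussian (u : E) :
    Integrable (fun x => inner ℝ u x ^ 2) (stdGaussian E) ∧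
      ∫ x, inner ℝ u x ^ 2 ∂stdGaussian E = ‖u‖ ^ 2 := by
  have h2 : MemLp (innerSL ℝ u) 2 (stdGaussian E) := IsGaussian.memLp_dual _ _ 2 (by norm_num)
  refine ⟨h2.integrable_sq, ?_⟩
  have h := variance_dual_stdGaussian (innerSL ℝ u)
  rw [variance_eq_sub h2, integral_strongDual_stdGaussian] at h
  simpa using h

theorem integral_norm_sq_comp_stdGaussian {F ι : Type*} [Fintype ι] [NormedAddCommGroup F]
    [InnerProductSpace ℝ F] [FiniteDimensional ℝ F] (M : E →L[ℝ] F) (f : OrthonormalBasis ι ℝ F) :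
    Integrable (fun x => ‖M x‖ ^ 2) (stdGaussian E) ∧
      ∫ x, ‖M x‖ ^ 2 ∂stdGaussian E = ∑ i, ‖M.adjoint (f i)‖ ^ 2 := by
  have h : (fun x => ‖M x‖ ^ 2) = fun x => ∑ i, inner ℝ (M.adjoint (f i)) x ^ 2 := by
    ext x
    rw [← f.sum_sq_norm_inner_right]
    simp [ContinuousLinearMap.adjoint_inner_left]
  rw [h]
  refine ⟨integrable_finsetSum _ fun i _ => (integral_inner_sq_stdGaussian _).1, ?_⟩
  rw [integral_finsetSum _ fun i _ => (integral_inner_sq_stdGaussian _).1]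
  exact Finset.sum_congr rfl fun i _ => (integral_inner_sq_stdGaussian _).2

/-- Markov's inequality: the mean of ‖M x‖² is the squared Hilbert–Schmidt norm of M, which may be
computed in any orthonormal basis. -/
theorem stdGaussian_le_norm_sq_comp_le {F ι : Type*} [Fintype ι] [NormedAddCommGroup F]
    [InnerProductSpace ℝ F] [FiniteDimensional ℝ F] (M : E →L[ℝ] F) (b : OrthonormalBasis ι ℝ E)
    {a : ℝ} (ha : 0 < a) :
    (stdGaussian E).real {x | a ≤ ‖M x‖ ^ 2} ≤ (∑ j, ‖M (b j)‖ ^ 2) / a := by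
  have h := integral_norm_sq_comp_stdGaussian M (stdOrthonormalBasis ℝ F)
  have h1 := mul_meas_ge_le_integral_of_nonneg
    (Filter.Eventually.of_forall fun x => by positivity) h.1 a
  rw [le_div_iff₀' ha]
  refine h1.trans_eq (h.2.trans ?_)
  simp_rw [← b.sum_sq_norm_inner_left, ContinuousLinearMap.adjoint_inner_left,
    ← (stdOrthonormalBasis ℝ F).sum_sq_norm_inner_right]
  rw [Finset.sum_comm]

theorem stdGaussian_le_norm_sq_starProjection_le (V : Submodule ℝ E) {a : ℝ} (ha : 0 < a) :
    (stdGaussian E).real {x | a ≤ ‖V.starProjection x‖ ^ 2} ≤ Module.finrank ℝ V / a := by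
  have h := integral_norm_sq_comp_stdGaussian V.orthogonalProjectionOnto (stdOrthonormalBasis ℝ V)
  have h1 := mul_meas_ge_le_integral_of_nonneg
    (Filter.Eventually.of_forall fun x => by positivity) h.1 a
  rw [le_div_iff₀' ha]
  refine h1.trans_eq (h.2.trans ?_)
  have h2 : ∀ i, ‖(stdOrthonormalBasis ℝ V i : E)‖ = 1 :=
    (stdOrthonormalBasis ℝ V).norm_eq_one
  simp [Submodule.adjoint_orthogonalProjectionOnto, -Submodule.coe_norm, h2]

end Gaussian

/-! ### Low-distortion maps keep a basis away from small subspaces -/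

section Distortion

open ProbabilityTheory Real

variable {E F : Type*} [NormedAddCommGroup E] [InnerProductSpace ℝ E] [FiniteDimensional ℝ E]
  [NormedAddCommGroup F] [InnerProductSpace ℝ F] [FiniteDimensional ℝ F]

/-- V is the orthogonal complement of the kernel of x ↦ P_W(Lx), so its dimension is the rank of
that map. -/
theorem exists_submodule_orthogonal_le_ker (L : E →L[ℝ] F) (W : Submodule ℝ F) :
    ∃ V : Submodule ℝ E, Module.finrank ℝ V ≤ Module.finrank ℝ W ∧
      ∀ x ∈ Vᗮ, W.starProjection (L x) = 0 := by
  set M : E →ₗ[ℝ] F := (W.starProjection : F →ₗ[ℝ] F) ∘ₗ (L : E →ₗ[ℝ] F)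
  refine ⟨(LinearMap.ker M)ᗮ, ?_, ?_⟩
  · have h1 := M.finrank_range_add_finrank_ker
    have h2 := (LinearMap.ker M).finrank_add_finrank_orthogonal
    have h3 : Module.finrank ℝ (LinearMap.range M) ≤ Module.finrank ℝ W := by
      apply Submodule.finrank_mono
      rintro _ ⟨x, rfl⟩
      exact W.starProjection_apply_mem _
    omega
  · intro x hx
    rw [Submodule.orthogonal_orthogonal] at hx
    exact hx

/-- Shrinking along `V` takes a vector out of the range of small distortion. -/
theorem norm_map_dilation_sq_lt (L : E →L[ℝ] F) (W : Submodule ℝ F) (V : Submodule ℝ E)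
    (hV : ∀ x ∈ Vᗮ, W.starProjection (L x) = 0) {ε σ : ℝ} (hε : 0 < ε)
    (hσ0 : 0 ≤ σ) (hσ : σ ^ 2 = 1 - 3 * ε) {x : E} (hx : x ≠ 0)
    (hL : ‖L x‖ ^ 2 ≤ (1 + ε) * ‖x‖ ^ 2)
    (hsign : 0 ≤ inner ℝ (L (V.starProjection x)) (L (x - V.starProjection x)))
    (hres : ‖L x - W.starProjection (L x)‖ ^ 2 ≤ ‖x‖ ^ 2 / 10)
    (hproj : ‖V.starProjection x‖ ^ 2 ≤ ‖x‖ ^ 2 / 10) :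
    ‖L (V.dilation σ x)‖ ^ 2 < (1 - ε) * ‖V.dilation σ x‖ ^ 2 := by
  have hN : 0 < ‖x‖ ^ 2 := by positivity
  have hσ1 : σ ≤ 1 := by nlinarith
  have hε1 : 3 * ε ≤ 1 := by nlinarith
  set y := L (V.starProjection x) with hy
  set z := L (x - V.starProjection x) with hz
  have h1 : L x = y + z := by rw [hy, hz, ← map_add]; congr 1; abel
  have h2 : L (V.dilation σ x) = σ • y + z := by
    rw [hy, hz, ← map_smul, ← map_add, V.dilation_apply]; congr 1; module
  have h3 : W.starProjection (L x) = W.starProjection y := by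
    rw [h1, map_add, hz, hV _ (V.sub_starProjection_mem_orthogonal x), add_zero]
  have h4 : ‖L x‖ ^ 2 = ‖W.starProjection (L x)‖ ^ 2 + ‖L x - W.starProjection (L x)‖ ^ 2 := by
    have h := W.inner_right_of_mem_orthogonal (W.starProjection_apply_mem (L x))
      (W.sub_starProjection_mem_orthogonal (L x))
    have h' := norm_add_sq_real (W.starProjection (L x)) (L x - W.starProjection (L x))
    rw [h, add_sub_cancel] at h'
    linarith
  have h5 : ‖W.starProjection y‖ ^ 2 ≤ ‖y‖ ^ 2 :=
    pow_le_pow_left₀ (norm_nonneg _) (W.norm_starProjection_apply_le y) 2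
  have h6 := norm_add_sq_real y z
  have h7 := norm_add_sq_real (σ • y) z
  rw [norm_smul, mul_pow, Real.norm_eq_abs, sq_abs, real_inner_smul_left] at h7
  rw [V.norm_dilation_sq, h2, h7]
  rw [h3] at h4 hres
  rw [← h1] at h6
  have h8 : 0 ≤ (1 - σ) * inner ℝ y z := mul_nonneg (by linarith) hsign
  -- The sign condition allows σ⟨y, z⟩ to be replaced by ⟨y, z⟩, so the left side is at most ‖Lx‖² -
  -- 3ε‖y‖²; and ‖y‖² ≥ ‖P_W Lx‖² ≥ ‖Lx‖² - ‖x‖²/10.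
  have h9 : σ ^ 2 * ‖y‖ ^ 2 + 2 * (σ * inner ℝ y z) + ‖z‖ ^ 2 ≤
      (1 - 3 * ε) * ‖L x‖ ^ 2 + 3 * ε * (‖x‖ ^ 2 / 10) := by
    rw [hσ]
    nlinarith
  have h10 : (1 - 3 * ε) * ‖L x‖ ^ 2 ≤ (1 - 3 * ε) * ((1 + ε) * ‖x‖ ^ 2) :=
    mul_le_mul_of_nonneg_left hL (by linarith)
  have h11 : (1 - ε) * (3 * ε) * ‖V.starProjection x‖ ^ 2 ≤ (1 - ε) * (3 * ε) * (‖x‖ ^ 2 / 10) :=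
    mul_le_mul_of_nonneg_left hproj (mul_nonneg (by linarith) (by linarith))
  rw [hσ]
  have h12 : 0 < ε * ‖x‖ ^ 2 := by positivity
  nlinarith [mul_pos hε h12]

variable [MeasurableSpace E] [BorelSpace E]

/-- A map which distorts few Gaussian vectors does not send an orthonormal basis close to a
subspace of small dimension. -/
theorem exists_le_norm_sub_starProjection_sq {ι : Type*} [Fintype ι] (L : E →L[ℝ] F)
    (b : OrthonormalBasis ι ℝ E) (W : Submodule ℝ F) {k : ℕ} (hWk : Module.finrank ℝ W ≤ k)
    (hd : 32 ≤ Module.finrank ℝ E) (hkd : 2000 * k ≤ Module.finrank ℝ E) {ε δ : ℝ} (hε : 0 < ε)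
    (hε4 : ε ≤ 1 / 4) (hδ : 0 < δ) (hδ1 : δ < 1 / 1024) (hkε : 21 * ε ^ 2 * k ≤ log (1 / δ))
    (hbad : (stdGaussian E).real
      {x | ‖L x‖ ^ 2 ∉ Set.Icc ((1 - ε) * ‖x‖ ^ 2) ((1 + ε) * ‖x‖ ^ 2)} ≤ 2 * δ) :
    ∃ j, 1 / 2000 ≤ ‖L (b j) - W.starProjection (L (b j))‖ ^ 2 := by
  by_contra! hcon
  obtain ⟨V, hVW, hV⟩ := exists_submodule_orthogonal_le_ker L W
  set γ := stdGaussian E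
  set d := Module.finrank ℝ E with hdd
  have hd0 : (0 : ℝ) < d := by
    have : 0 < d := by omega
    exact_mod_cast this
  set bad := {x : E | ‖L x‖ ^ 2 ∉ Set.Icc ((1 - ε) * ‖x‖ ^ 2) ((1 + ε) * ‖x‖ ^ 2)} with hbad_def
  have hbad_meas : MeasurableSet bad := by
    have : bad = {x : E | ‖L x‖ ^ 2 < (1 - ε) * ‖x‖ ^ 2} ∪
        {x | (1 + ε) * ‖x‖ ^ 2 < ‖L x‖ ^ 2} := by
      ext x
      simp only [hbad_def, Set.mem_Icc, Set.mem_ofPred_eq, Set.mem_union, not_and_or, not_le]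
    rw [this]
    exact (isOpen_lt (by fun_prop) (by fun_prop)).measurableSet.union
      (isOpen_lt (by fun_prop) (by fun_prop)).measurableSet
  -- Outside `short` one has ‖x‖² > d/4, so the threshold d/40 is below ‖x‖²/10, as
  -- `norm_map_dilation_sq_lt` requires.
  set far := {x : E | (d : ℝ) / 40 ≤ ‖(L - W.starProjection ∘L L) x‖ ^ 2}
  set long := {x : E | (d : ℝ) / 40 ≤ ‖V.starProjection x‖ ^ 2}
  set short := {x : E | ‖x‖ ^ 2 ≤ (d : ℝ) / 4}
  have hfar : γ.real far ≤ 1 / 50 := by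
    refine (stdGaussian_le_norm_sq_comp_le _ b (by positivity)).trans ?_
    rw [div_le_iff₀ (by positivity)]
    have hcard : Fintype.card ι = d := (Module.finrank_eq_card_basis b.toBasis).symm
    calc _ ≤ ∑ _j : ι, (1 / 2000 : ℝ) := Finset.sum_le_sum fun j _ => (hcon j).le
      _ = 1 / 50 * (d / 40) := by simp [hcard]; ring
  have hlong : γ.real long ≤ 1 / 50 := by
    refine (stdGaussian_le_norm_sq_starProjection_le V (by positivity)).trans ?_
    rw [div_le_iff₀ (by positivity)]
    have h1 : (2000 * Module.finrank ℝ V : ℝ) ≤ d := by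
      have : 2000 * Module.finrank ℝ V ≤ d := by omega
      exact_mod_cast this
    linarith
  have hshort : γ.real short ≤ 1 / 50 := stdGaussian_norm_sq_le hd
  set exc := bad ∪ far ∪ long ∪ short with hexc
  have hexc_le : γ.real exc ≤ 1 / 4 := by
    have h1 := measureReal_union_le (μ := γ) (bad ∪ far ∪ long) short
    have h2 := measureReal_union_le (μ := γ) (bad ∪ far) long
    have h3 := measureReal_union_le (μ := γ) bad far
    linarith
  set σ := √(1 - 3 * ε) with hσ_def
  have hσ0 : 0 < σ := Real.sqrt_pos.2 (by linarith)
  have hσ : σ ^ 2 = 1 - 3 * ε := Real.sq_sqrt (by linarith)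
  have hmove : ∀ x, x ∉ exc →
      0 ≤ inner ℝ (L (V.starProjection x)) (L (x - V.starProjection x)) →
      x ∈ V.dilation σ ⁻¹' bad := by
    intro x hx hs
    simp only [hexc, Set.mem_union, not_or] at hx
    obtain ⟨⟨⟨hx1, hx2⟩, hx3⟩, hx4⟩ := hx
    have hx1' : ‖L x‖ ^ 2 ≤ (1 + ε) * ‖x‖ ^ 2 := (not_not.1 hx1).2
    have hx2' : ‖L x - W.starProjection (L x)‖ ^ 2 < d / 40 := not_le.1 hx2
    have hx3' : ‖V.starProjection x‖ ^ 2 < d / 40 := not_le.1 hx3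
    have hx4' : d / 4 < ‖x‖ ^ 2 := not_le.1 hx4
    have hx0 : x ≠ 0 := by
      rintro rfl
      simp at hx4'
      linarith
    have h := norm_map_dilation_sq_lt L W V hV hε hσ0.le hσ hx0 hx1' hs (by linarith) (by linarith)
    exact fun hmem => absurd hmem.1 (not_le.2 h)
  have hrefl : ∀ s : Set E, γ.real (V.reflection ⁻¹' s) = γ.real s := by
    intro s
    have h1 : Measure.map V.reflection γ = γ := stdGaussian_map V.reflection
    have h2 : γ (V.reflection ⁻¹' s) = γ s := by
      conv_rhs => rw [← h1]
      exact (V.reflection.toHomeomorph.toMeasurableEquiv.map_apply s).symm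
    rw [measureReal_def, measureReal_def, h2]
  -- If neither x nor its reflection is exceptional, the one with nonnegative cross term is moved
  -- into `bad`. Hence 1 ≤ 2p + 2 · (1/4).
  have hcover : (Set.univ : Set E) ⊆ (V.dilation σ ⁻¹' bad ∪ V.reflection ⁻¹' (V.dilation σ ⁻¹' bad)) ∪
      (exc ∪ V.reflection ⁻¹' exc) := by
    intro x _
    by_cases h1 : x ∈ exc
    · exact Or.inr (Or.inl h1)
    by_cases h2 : V.reflection x ∈ exc
    · exact Or.inr (Or.inr h2)
    left
    rcases le_total 0 (inner ℝ (L (V.starProjection x)) (L (x - V.starProjection x))) with h | h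
    · exact Or.inl (hmove x h1 h)
    · refine Or.inr (hmove _ h2 ?_)
      have h3 : V.starProjection (V.reflection x) = V.starProjection x := by
        have : V.starProjection (V.starProjection x) = V.starProjection x :=
          V.starProjection_eq_self_iff.2 (V.starProjection_apply_mem x)
        rw [V.reflection_apply, two_smul, map_sub, map_add, this]
        abel
      have h4 : V.reflection x - V.starProjection x = -(x - V.starProjection x) := by
        rw [V.reflection_apply]; module
      rw [h3, h4, map_neg, inner_neg_right]
      linarith
  have hp : 1 / 4 ≤ γ.real (V.dilation σ ⁻¹' bad) := by
    have h0 := measureReal_mono (μ := γ) hcover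
    rw [probReal_univ] at h0
    have h1 := measureReal_union_le (μ := γ)
      (V.dilation σ ⁻¹' bad ∪ V.reflection ⁻¹' (V.dilation σ ⁻¹' bad)) (exc ∪ V.reflection ⁻¹' exc)
    have h2 := measureReal_union_le (μ := γ)
      (V.dilation σ ⁻¹' bad) (V.reflection ⁻¹' (V.dilation σ ⁻¹' bad))
    have h3 := measureReal_union_le (μ := γ) exc (V.reflection ⁻¹' exc)
    rw [hrefl] at h2 h3
    linarith
  have hq0 : 0 < 2 / σ ^ 2 - 1 := by
    rw [sub_pos, lt_div_iff₀ (by positivity), hσ]; linarith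
  have htilt := stdGaussian_preimage_dilation_sq_le V hσ0 (Real.sqrt_pos.2 hq0)
    (Real.sq_sqrt hq0.le) hbad_meas
  set θ := σ ^ 2 * √(2 / σ ^ 2 - 1) with hθ
  have hθ0 : 0 < θ := by positivity
  have hθ2 : θ ^ 2 = 1 - 9 * ε ^ 2 := by
    rw [hθ, mul_pow, Real.sq_sqrt hq0.le, hσ]
    have : 1 - 3 * ε ≠ 0 := by linarith
    field_simp
    ring
  -- The constant 21 gives (1 - 9ε²)(1 + 21ε²) ≥ 1 for all ε² ≤ 12/189, which covers ε ≤ 1/4.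
  have hθ3 : exp (-(21 / 2 * ε ^ 2)) ≤ θ := by
    have h1 : exp (-(21 * ε ^ 2)) ≤ θ ^ 2 := by
      rw [exp_neg, hθ2]
      have h2 := add_one_le_exp (21 * ε ^ 2)
      rw [inv_le_iff_one_le_mul₀ (exp_pos _)]
      have h3 : ε ^ 2 ≤ 1 / 16 := by nlinarith
      have h4 : (1 - 9 * ε ^ 2) * (21 * ε ^ 2 + 1) ≤ (1 - 9 * ε ^ 2) * exp (21 * ε ^ 2) :=
        mul_le_mul_of_nonneg_left h2 (by linarith)
      nlinarith [sq_nonneg ε]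
    refine (sq_le_sq₀ (exp_pos _).le hθ0.le).1 ?_
    have h2 : exp (-(21 / 2 * ε ^ 2)) ^ 2 = exp (-(21 * ε ^ 2)) := by
      rw [← exp_nat_mul]; congr 1; push_cast; ring
    rwa [h2]
  have hθ4 : θ ≤ 1 := by nlinarith [sq_nonneg ε]
  have hθ5 : √δ ≤ θ ^ Module.finrank ℝ V := by
    calc √δ = exp (-(log (1 / δ) / 2)) := by
          rw [one_div, log_inv, neg_div, neg_neg, ← log_sqrt hδ.le, exp_log (Real.sqrt_pos.2 hδ)]
      _ ≤ exp (k * -(21 / 2 * ε ^ 2)) := by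
          apply exp_le_exp.2; linarith
      _ = exp (-(21 / 2 * ε ^ 2)) ^ k := exp_nat_mul _ _
      _ ≤ θ ^ k := pow_le_pow_left₀ (exp_pos _).le hθ3 k
      _ ≤ θ ^ Module.finrank ℝ V := pow_le_pow_of_le_one hθ0.le hθ4 (hVW.trans hWk)
  have hsδ : 0 < √δ := Real.sqrt_pos.2 hδ
  have hfin : (1 / 4 : ℝ) ^ 2 ≤ 2 * √δ := by
    calc (1 / 4 : ℝ) ^ 2 ≤ _ := pow_le_pow_left₀ (by norm_num) hp 2
      _ ≤ _ := htilt
      _ ≤ (√δ)⁻¹ * (2 * δ) := by gcongr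
      _ = 2 * √δ := by
          field_simp
          rw [Real.sq_sqrt hδ.le]
  have h32 : √δ < 1 / 32 := by
    rw [Real.sqrt_lt' (by norm_num)]; norm_num at hδ1 ⊢; exact hδ1
  linarith

end Distortion

/-! ### From Gaussian distortion of a fixed matrix to its minors -/

section ScaledMatrix

open ProbabilityTheory Real

/-- The linear map `x ↦ s^{-1/2} B x` between Euclidean spaces. -/
noncomputable def scaledMap {m d : ℕ} (s : ℕ) (B : Matrix (Fin m) (Fin d) ℝ) :
    EuclideanSpace ℝ (Fin d) →L[ℝ] EuclideanSpace ℝ (Fin m) :=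
  (Matrix.toEuclideanLin ((s : ℝ) ^ (-(1 / 2) : ℝ) • B)).toContinuousLinearMap

theorem scaledMap_apply {m d : ℕ} (s : ℕ) (B : Matrix (Fin m) (Fin d) ℝ)
    (x : EuclideanSpace ℝ (Fin d)) :
    scaledMap s B x = WithLp.toLp 2 ((s : ℝ) ^ (-(1 / 2) : ℝ) • Matrix.mulVec B x.ofLp) := by
  ext i
  simp [scaledMap, Matrix.toLpLin_apply]

theorem scaledMap_basisFun {m d : ℕ} (s : ℕ) (B : Matrix (Fin m) (Fin d) ℝ) (j : Fin d) :
    scaledMap s B (EuclideanSpace.basisFun (Fin d) ℝ j) =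
      (s : ℝ) ^ (-(1 / 2) : ℝ) • WithLp.toLp 2 (B.col j) := by
  rw [scaledMap_apply]
  ext i
  simp

/-- The vectors whose squared norm is distorted by more than a factor `1 ± ε`. -/
def distortedSet {m d : ℕ} (ε : ℝ) (s : ℕ) (B : Matrix (Fin m) (Fin d) ℝ) :
    Set (EuclideanSpace ℝ (Fin d)) :=
  {x | ‖scaledMap s B x‖ ^ 2 ∉ Set.Icc ((1 - ε) * ‖x‖ ^ 2) ((1 + ε) * ‖x‖ ^ 2)}

theorem measurableSet_distorted (m d : ℕ) (ε : ℝ) (s : ℕ) :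
    MeasurableSet {p : Matrix (Fin m) (Fin d) ℝ × EuclideanSpace ℝ (Fin d) |
      p.2 ∈ distortedSet ε s p.1} := by
  have hentry : ∀ i j, Measurable fun B : Matrix (Fin m) (Fin d) ℝ => B i j := fun i j =>
    (measurable_pi_apply j).comp (measurable_pi_apply (X := fun _ : Fin m => Fin d → ℝ) i)
  have h1 : Measurable fun p : Matrix (Fin m) (Fin d) ℝ × EuclideanSpace ℝ (Fin d) =>
      ‖scaledMap s p.1 p.2‖ ^ 2 := by
    simp only [scaledMap_apply, EuclideanSpace.norm_sq_eq, Pi.smul_apply, smul_eq_mul,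
      Matrix.mulVec, dotProduct]
    refine Finset.measurable_sum _ fun i _ => ?_
    refine ((Measurable.const_mul (Finset.measurable_sum (M := ℝ) _ fun j _ => ?_) _).norm).pow_const 2
    exact ((hentry i j).comp measurable_fst).mul (by fun_prop)
  have h2 : Measurable fun p : Matrix (Fin m) (Fin d) ℝ × EuclideanSpace ℝ (Fin d) =>
      ‖p.2‖ ^ 2 := by fun_prop
  exact ((measurableSet_le (h2.const_mul _) h1).inter (measurableSet_le h1 (h2.const_mul _))).compl

theorem exists_isSquareSubmatrix_rpow_le_abs_det {m d s : ℕ} {ε δ t : ℝ}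
    (B : Matrix (Fin m) (Fin d) ℝ) (hs : 0 < s) (hε : 0 < ε) (hε4 : ε ≤ 1 / 4) (hδ : 0 < δ)
    (hδC : δ ≤ exp (-250)) (hm : t * ε ^ (-2 : ℤ) * log (1 / δ) = m) (ht : 1 ≤ t) (hmd : m ≤ d)
    (hB : stdGaussian (EuclideanSpace ℝ (Fin d)) (distortedSet ε s B) ≤ ENNReal.ofReal (2 * δ)) :
    ∃ (k : ℕ) (F : Matrix (Fin k) (Fin k) ℝ), IsSquareSubmatrix F B ∧
      ((1 / 4000 : ℝ) ^ 2 * (s : ℝ) / (3 * (exp 1 * t) ^ 2)) ^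
        ((⌈(1 / 4000 : ℝ) * (m : ℝ) / t⌉₊ : ℝ) / 2) ≤ |F.det| := by
  have hs0 : (0 : ℝ) < s := by exact_mod_cast hs
  have ht0 : 0 < t := by linarith
  have hlog : 250 ≤ log (1 / δ) := by
    rw [one_div, log_inv]
    have := (log_le_iff_le_exp hδ).2 hδC
    linarith
  obtain ⟨n, hn⟩ : ∃ n : ℝ, n = ε ^ (-2 : ℤ) * log (1 / δ) := ⟨_, rfl⟩
  have hmn : (m : ℝ) = t * n := by rw [hn, ← mul_assoc, hm]
  have hεn : ε ^ 2 * n = log (1 / δ) := by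
    rw [hn, zpow_neg, ← mul_assoc, zpow_ofNat, mul_inv_cancel₀ (by positivity), one_mul]
  -- This fixes C = exp(-250): n ≥ 16 · 250. It makes the rounding harmless, since k < n/4000 + 1 ≤
  -- n/2000.
  have hn4000 : 4000 ≤ n := by
    have h1 : ε ^ 2 ≤ 1 / 16 := by nlinarith
    by_contra! h
    rcases le_total n 0 with h0 | h0
    · nlinarith [sq_nonneg ε]
    · nlinarith
  have hnm : n ≤ m := by rw [hmn]; nlinarith
  have hmd' : (m : ℝ) ≤ d := by exact_mod_cast hmd
  have hk_eq : (1 / 4000 : ℝ) * (m : ℝ) / t = n / 4000 := by rw [hmn]; field_simp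
  rw [hk_eq]
  set k := ⌈n / 4000⌉₊ with hk
  have hk1 : n / 4000 ≤ k := Nat.le_ceil _
  have hk2 : (k : ℝ) < n / 4000 + 1 := Nat.ceil_lt_add_one (by linarith)
  have hk0 : 0 < k := Nat.ceil_pos.2 (by linarith)
  have hδ1 : δ < 1 / 1024 := by
    refine hδC.trans_lt ?_
    rw [exp_neg, ← one_div]
    refine one_div_lt_one_div_of_lt (by norm_num) ?_
    have := quadratic_le_exp_of_nonneg (x := 250) (by norm_num)
    linarith
  have hfin : Module.finrank ℝ (EuclideanSpace ℝ (Fin d)) = d := finrank_euclideanSpace_fin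
  obtain ⟨F, hF, hdet⟩ := exists_isSquareSubmatrix_le_det_sq hk0 B (ρ := √(s / 2000))
    (by positivity) (by
      intro W hW
      obtain ⟨j, hj⟩ := exists_le_norm_sub_starProjection_sq (scaledMap s B)
        (EuclideanSpace.basisFun (Fin d) ℝ) W hW.le
        (by
          rw [hfin]
          have : (32 : ℝ) ≤ d := by linarith
          exact_mod_cast this)
        (by
          rw [hfin]
          have : (2000 * k : ℝ) ≤ d := by linarith
          exact_mod_cast this)
        hε hε4 hδ hδ1
        (by
          have h1 : (k : ℝ) ≤ n / 2000 := by linarith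
          have h2 : ε ^ 2 * k ≤ ε ^ 2 * (n / 2000) := by gcongr
          linarith)
        (ENNReal.toReal_le_of_le_ofReal (by positivity) hB)
      refine ⟨j, ?_⟩
      rw [scaledMap_basisFun, map_smul, ← smul_sub, norm_smul, mul_pow, norm_eq_abs, sq_abs,
        ← rpow_natCast, ← rpow_mul hs0.le] at hj
      norm_num at hj
      rw [rpow_neg_one, le_inv_mul_iff₀ hs0] at hj
      rw [Real.sqrt_le_left (norm_nonneg _)]
      linarith)
  refine ⟨k, F, hF, ?_⟩
  rw [Real.sq_sqrt (by positivity)] at hdet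
  set x := (1 / 4000 : ℝ) ^ 2 * (s : ℝ) / (3 * (exp 1 * t) ^ 2) with hx
  have hx0 : 0 < x := by positivity
  have he1 : 1 ≤ exp 1 := one_le_exp (by norm_num)
  have hm0 : (0 : ℝ) < m := by linarith
  -- Together with k! ≥ (k/e)^k this turns the determinant bound into x^k ≤ det²; a factor 6et is to
  -- spare.
  have hmx : m * x ≤ k / exp 1 * (s / 2000) := by
    have h1 : m * x = (n / 4000) / exp 1 * (s / 2000) * (1 / (6 * (exp 1 * t))) := by
      rw [hx, hmn]
      field_simp
      norm_num
    rw [h1]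
    have h2 : 1 / (6 * (exp 1 * t)) ≤ 1 := by
      rw [div_le_one (by positivity)]
      nlinarith
    calc _ ≤ (n / 4000) / exp 1 * (s / 2000) * 1 :=
          mul_le_mul_of_nonneg_left h2 (by positivity)
      _ ≤ _ := by rw [mul_one]; gcongr
  have hfact : ((k : ℝ) / exp 1) ^ k ≤ k.factorial := by
    have h1 := pow_div_factorial_le_exp (x := (k : ℝ)) (by positivity) k
    rw [div_le_iff₀ (by positivity)] at h1
    rw [div_pow, div_le_iff₀ (by positivity), ← exp_nat_mul, mul_one]
    linarith
  have hxk : x ^ k ≤ F.det ^ 2 := by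
    have h1 : (m : ℝ) ^ k * x ^ k ≤ (m : ℝ) ^ k * F.det ^ 2 := by
      calc (m : ℝ) ^ k * x ^ k = (m * x) ^ k := (mul_pow _ _ _).symm
        _ ≤ (k / exp 1 * (s / 2000)) ^ k := pow_le_pow_left₀ (by positivity) hmx k
        _ = (k / exp 1) ^ k * (s / 2000) ^ k := mul_pow _ _ _
        _ ≤ k.factorial * (s / 2000) ^ k := by gcongr
        _ ≤ _ := hdet
    exact le_of_mul_le_mul_left h1 (by positivity)
  rw [div_eq_mul_one_div, rpow_mul hx0.le, rpow_natCast, ← sqrt_eq_rpow, ← sqrt_sq_eq_abs]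
  exact Real.sqrt_le_sqrt hxk

end ScaledMatrix

/-! ### Averaging over the random matrix -/

theorem lemma3 :
    ∃ C : ℝ, 0 < C ∧ ∃ c : ℝ, 0 < c ∧ c < 1 ∧
      ∀ {Ω : Type*} [MeasurableSpace Ω] (P : Measure Ω) [IsProbabilityMeasure P]
        (m d s : ℕ) (ε δ t : ℝ) (A : Ω → Matrix (Fin m) (Fin d) ℝ),
        IsScaledJL P A ε δ s → ε ≤ 1 / 4 → δ ≤ C →
        t * ε ^ (-2 : ℤ) * Real.log (1 / δ) = (m : ℝ) → 1 ≤ t → m ≤ d →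
        ∃ S : Set (Matrix (Fin m) (Fin d) ℝ),
          MeasurableSet S ∧ S ⊆ (P.map A).support ∧ 1 / 2 ≤ P {ω | A ω ∈ S} ∧
          ∀ B ∈ S, ∃ (k : ℕ) (F : Matrix (Fin k) (Fin k) ℝ),
            IsSquareSubmatrix F B ∧
            (c ^ 2 * (s : ℝ) / (3 * (Real.exp 1 * t) ^ 2)) ^ ((⌈c * (m : ℝ) / t⌉₊ : ℝ) / 2)
              ≤ |F.det| := by
  refine ⟨Real.exp (-250), Real.exp_pos _, 1 / 4000, by norm_num, by norm_num, ?_⟩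
  intro Ω _ P _ m d s ε δ t A hA hε4 hδC hm ht hmd
  have hAm := hA.measurable
  have : SecondCountableTopology (Matrix (Fin m) (Fin d) ℝ) :=
    inferInstanceAs (SecondCountableTopology (Fin m → Fin d → ℝ))
  have hμ : IsProbabilityMeasure (P.map A) := Measure.isProbabilityMeasure_map hAm.aemeasurable
  set γ := ProbabilityTheory.stdGaussian (EuclideanSpace ℝ (Fin d))
  have hD := measurableSet_distorted m d ε s
  have hγ_meas : Measurable fun B : Matrix (Fin m) (Fin d) ℝ => γ (distortedSet ε s B) :=
    measurable_measure_prodMk_left hD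
  have hgood : MeasurableSet {B : Matrix (Fin m) (Fin d) ℝ |
      γ (distortedSet ε s B) ≤ ENNReal.ofReal (2 * δ)} := measurableSet_le hγ_meas measurable_const
  have havg : ∫⁻ B, γ (distortedSet ε s B) ∂(P.map A) ≤ ENNReal.ofReal δ := by
    calc ∫⁻ B, γ (distortedSet ε s B) ∂(P.map A) = ((P.map A).prod γ) _ :=
          (Measure.prod_apply hD).symm
      _ = ∫⁻ x, (P.map A) {B | x ∈ distortedSet ε s B} ∂γ := Measure.prod_apply_symm hD
      _ ≤ ∫⁻ _, ENNReal.ofReal δ ∂γ := by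
          refine lintegral_mono fun x => ?_
          have hx : MeasurableSet {B : Matrix (Fin m) (Fin d) ℝ | x ∈ distortedSet ε s B} :=
            measurable_prodMk_right (y := x) hD
          rw [Measure.map_apply hAm hx]
          refine (measure_mono fun ω hω => ?_).trans (hA.norm_preserved x).le
          have hω' : ‖scaledMap s (A ω) x‖ ^ 2 ∉
              Set.Icc ((1 - ε) * ‖x‖ ^ 2) ((1 + ε) * ‖x‖ ^ 2) := hω
          rwa [scaledMap_apply] at hω'
      _ = ENNReal.ofReal δ := by simp
  have hδ0 : ENNReal.ofReal (2 * δ) ≠ 0 := by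
    simpa using hA.delta_pos
  -- Markov's inequality for the Gaussian measure of the distorted set, whose mean is at most δ.
  have hbad : (P.map A) {B | ENNReal.ofReal (2 * δ) ≤ γ (distortedSet ε s B)} ≤ 1 / 2 := by
    refine (meas_ge_le_lintegral_div hγ_meas.aemeasurable hδ0 ENNReal.ofReal_ne_top).trans ?_
    refine (ENNReal.div_le_div_right havg _).trans ?_
    have h := hA.delta_pos
    rw [← ENNReal.ofReal_div_of_pos (by linarith)]
    refine ENNReal.ofReal_le_of_le_toReal ?_
    rw [show δ / (2 * δ) = 1 / 2 by field_simp]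
    simp
  -- Intersecting with the support costs no probability, because its complement is null.
  refine ⟨(P.map A).support ∩ {B | γ (distortedSet ε s B) ≤ ENNReal.ofReal (2 * δ)},
    Measure.isClosed_support.measurableSet.inter hgood, Set.inter_subset_left, ?_, ?_⟩
  · have h1 : P {ω | A ω ∈ (P.map A).support ∩
        {B | γ (distortedSet ε s B) ≤ ENNReal.ofReal (2 * δ)}} =
        (P.map A) {B | γ (distortedSet ε s B) ≤ ENNReal.ofReal (2 * δ)} := by
      rw [← measure_inter_conull' (s := {B | γ (distortedSet ε s B) ≤ ENNReal.ofReal (2 * δ)})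
        (t := (P.map A).support), Set.inter_comm,
        Measure.map_apply hAm (hgood.inter Measure.isClosed_support.measurableSet)]
      · rw [Set.inter_comm]; rfl
      · exact measure_mono_null (fun x hx => hx.2) Measure.measure_compl_support
    rw [h1]
    have h2 : (P.map A) {B | γ (distortedSet ε s B) ≤ ENNReal.ofReal (2 * δ)}ᶜ ≤ 1 / 2 := by
      refine (measure_mono fun B hB => ?_).trans hbad
      exact (not_le.1 (show ¬ γ (distortedSet ε s B) ≤ ENNReal.ofReal (2 * δ) from hB)).le
    rw [prob_compl_eq_one_sub hgood, tsub_le_iff_left] at h2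
    have h3 : (1 / 2 : ENNReal) + 1 / 2 = 1 := by
      rw [one_div]; exact ENNReal.inv_two_add_inv_two
    refine (ENNReal.add_le_add_iff_right (a := 1 / 2) (by simp)).1 ?_
    rwa [h3]
  · intro B hB
    exact exists_isSquareSubmatrix_rpow_le_abs_det B hA.scale_pos hA.eps_pos hε4 hA.delta_pos hδC
      hm ht hmd hB.2
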